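/- Let $\mathcal H$ be a complex Hilbert space with inner product $\langle\cdot,\cdot\rangle$, antilinear in the first argument. Let $A$ be a closed symmetric linear operator in $\mathcal H$, not necessarily densely defined. Its adjoint is the linear relation $$A^*=\{(\eta,\omega)\in\mathcal H\oplus\mathcal H:\ \langle\eta,A\varphi\rangle=\langle\omega,\varphi\rangle\ \text{for all }\varphi\in\operatorname{dom}(A)\},$$ symmetry means $A\subset A^*$ (identifying $A$ with its graph), and $\ker(A^*-zI)=\{\eta:(\eta,z\eta)\in A^*\}$. Suppose that $A$ belongs to the class $\mathscr S(\mathcal H)$, that is, in addition: * $A$ is regular: for every $z\in\mathbb C$ there is $c_z>0$ with $\|(A-zI)\varphi\|\ge c_z\|\varphi\|$ for all $\varphi\in\operatorname{dom}(A)$; * both deficiency indices of $A$ are one: $n_\pm(A)=\dim\bigl[\mathcal H\ominus\operatorname{ran}(A\mp iI)\bigr]=1$. Let $J$ be an involution of $\mathcal H$, that is, a map of $\mathcal H$ onto itself with $J(a\varphi+b\psi)=\bar a J\varphi+\bar b J\psi$, $J^2=I$ and $\langle J\psi,J\varphi\rangle=\langle\varphi,\psi\rangle$ (for instance one that commutes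 with all canonical selfadjoint extensions of $A$). Let $\xi_A:\mathbb C\to\mathcal H$ be an entire function without zeros such that $\xi_A(z)\in\ker(A^*-zI)$ and $J\xi_A(z)=\xi_A(\bar z)$ for all $z\in\mathbb C$. For $\varphi\in\mathcal H$ define $$(\Phi_A\varphi)(z)=\langle\xi_A(\bar z),\varphi\rangle,\qquad z\in\mathbb C.$$ Then $\Phi_A$ is injective, so that $\langle\Phi_A\eta,\Phi_A\varphi\rangle:=\langle\eta,\varphi\rangle$ is a well-defined inner product on the linear space of functions $\widehat{\mathcal H}=\Phi_A\mathcal H$, and with this inner product $\widehat{\mathcal H}$ is a de Branges space; that is, $\widehat{\mathcal H}$ is a Hilbert space of entire functions such that * (A1) for every $w\in\mathbb C$ the linear functional $f\mapsto f(w)$ on $\widehat{\mathcal H}$ is continuous; * (A2) for every $f\in\widehat{\mathcal H}$ and every non-real zero $w$ of $f$, the function $f(z)(z-\bar w)(z-w)^{-1}$ (continued analytically to $z=w$) belongs to $\widehat{\mathcal H}$ and has the same norm as $f$; * (A3) for every $f\in\widehat{\mathcal H}$ the function $f^\#(z):=\overline{f(\bar z)}$ belongs to $\widehat{\mathcal H}$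 and has the same norm as $f$. -/

import Mathlib

open scoped ComplexConjugate

noncomputable section

namespace DeBrangesModel

section Operators

variable {H : Type*} [NormedAddCommGroup H] [InnerProductSpace ℂ H]

/-- The operator `A` is symmetric: `A ⊆ A*` as subsets of `H × H`. Here `A.graph.adjoint` is the
adjoint linear relation, so `A` need not be densely defined. -/
def IsSymmetricOp (A : H →ₗ.[ℂ] H) : Prop :=
  A.graph ≤ A.graph.adjoint

/-- The range of `A - z I` (with domain `dom A`). -/
def ranSub (A : H →ₗ.[ℂ] H) (z : ℂ) : Submodule ℂ H :=
  LinearMap.range (A.toFun - z • A.domain.subtype)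

/-- The kernel of `A* - z I`, where `A*` is the adjoint linear relation:
all `η` such that the pair `(η, z η)` belongs to `A*`. -/
def kerAdjointSub (A : H →ₗ.[ℂ] H) (z : ℂ) : Submodule ℂ H :=
  A.graph.adjoint.comap (LinearMap.prod LinearMap.id (z • LinearMap.id))

/-- The dimension of `H ⊖ ran (A - z I)`. -/
def defect (A : H →ₗ.[ℂ] H) (z : ℂ) : Cardinal :=
  Module.rank ℂ (ranSub A z)ᗮ

/-- The deficiency index `n₊(A)`, computed at the point `i` of the upper half-plane. -/
def nPlus (A : H →ₗ.[ℂ] H) : Cardinal :=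
  defect A Complex.I

/-- The deficiency index `n₋(A)`, computed at the point `-i` of the lower half-plane. -/
def nMinus (A : H →ₗ.[ℂ] H) : Cardinal :=
  defect A (-Complex.I)

/-- Every complex number is a point of regular type of `A`. -/
def IsRegularOp (A : H →ₗ.[ℂ] H) : Prop :=
  ∀ z : ℂ, ∃ c : ℝ, 0 < c ∧ ∀ φ : A.domain, c * ‖(φ : H)‖ ≤ ‖A φ - z • (φ : H)‖

/-- The class `S(H)` of regular, closed, symmetric operators in `H`, not necessarily densely
defined, with both deficiency indices equal to one. -/
structure ClassS (A : H →ₗ.[ℂ] H) : Prop where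
  regular : IsRegularOp A
  closed : A.IsClosed
  symmetric : IsSymmetricOp A
  nPlus_eq_one : nPlus A = 1
  nMinus_eq_one : nMinus A = 1

/-- An involution (conjugation) of `H`. -/
structure IsInvolution (J : H → H) : Prop where
  surjective : Function.Surjective J
  antilinear : ∀ (a b : ℂ) (φ ψ : H), J (a • φ + b • ψ) = conj a • J φ + conj b • J ψ
  involutive : ∀ φ : H, J (J φ) = φ
  inner_map : ∀ φ ψ : H, inner ℂ (J ψ) (J φ) = inner ℂ φ ψ

/-- A zero-free entire function `ξ` with `ξ(z) ∈ ker (A* - z I)` which is real with respect to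
`J`. -/
structure IsModelFunction (A : H →ₗ.[ℂ] H) (J : H → H) (ξ : ℂ → H) : Prop where
  entire : Differentiable ℂ ξ
  zero_free : ∀ z : ℂ, ξ z ≠ 0
  mem_ker : ∀ z : ℂ, ξ z ∈ kerAdjointSub A z
  real : ∀ z : ℂ, J (ξ z) = ξ (conj z)

/-- The map `(Φ φ)(z) = ⟨ξ(z̄), φ⟩`, the inner product being antilinear in the first argument. -/
def modelMap (ξ : ℂ → H) : H →ₗ[ℂ] (ℂ → ℂ) where
  toFun φ := fun z => inner ℂ (ξ (conj z)) φ
  map_add' φ ψ := by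
    funext z
    exact inner_add_right _ _ _
  map_smul' c φ := by
    funext z
    exact inner_smul_right _ _ _

end Operators

section DeBranges

variable (B : Submodule ℂ (ℂ → ℂ)) (ip : InnerProductSpace.Core ℂ B)

/-- The norm `‖f‖ = ⟨f, f⟩ ^ (1/2)` of the inner product `ip`. -/
def ipNorm (f : B) : ℝ :=
  ip.toNormedAddCommGroup.norm f

/-- The uniform structure that the norm of `ip` induces on `B` (not that of pointwise
convergence). -/
abbrev ipUniformSpace : UniformSpace B :=
  ip.toNormedAddCommGroup.toMetricSpace.toPseudoMetricSpace.toUniformSpace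

/-- A linear space `B` of functions with an inner product `ip` is a de Branges space: it is a
Hilbert space of entire functions which satisfies the axioms (A1), (A2) and (A3). -/
structure IsDeBrangesSpace : Prop where
  entire : ∀ f : B, Differentiable ℂ (f : ℂ → ℂ)
  complete : @CompleteSpace B (ipUniformSpace B ip)
  /-- (A1) point evaluations are continuous for the norm of `ip`. -/
  continuous_eval : ∀ w : ℂ,
    @Continuous B ℂ (ipUniformSpace B ip).toTopologicalSpace _ (fun f : B => (f : ℂ → ℂ) w)
  /-- (A2) non-real zeros may be reflected. The value at the removable singularity `w` is
  determined by the continuity of `g`. -/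
  reflect_zero : ∀ (f : B) (w : ℂ), w.im ≠ 0 → (f : ℂ → ℂ) w = 0 →
    ∃ g : B, (∀ z : ℂ, z ≠ w → (g : ℂ → ℂ) z = (f : ℂ → ℂ) z * (z - conj w) * (z - w)⁻¹) ∧
      ipNorm B ip g = ipNorm B ip f
  /-- (A3) the function `z ↦ conj (f (conj z))` belongs to `B` and has the norm of `f`. -/
  sharp : ∀ f : B, ∃ g : B, (∀ z : ℂ, (g : ℂ → ℂ) z = conj ((f : ℂ → ℂ) (conj z))) ∧
    ipNorm B ip g = ipNorm B ip f

end DeBranges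

end DeBrangesModel

end

open scoped ComplexConjugate

namespace DeBrangesModel

/-! ### Symmetric and regular operators: ranges of `A - z` and inverses on them -/

section Operators

variable {H : Type*} [NormedAddCommGroup H] [InnerProductSpace ℂ H]

/-! The identity `⟨ξ(z̄), (A - w)ψ⟩ = (z - w)⟨ξ(z̄), ψ⟩` makes `A` multiplication by `z` and puts
`ran (A - z)` inside `ξ(z̄)ᗮ`. The two agree at `i` because `n₊ = 1`, hence everywhere, since the
set of such `z` is clopen (`IsModelFunction.mem_ranSub_of_inner_eq_zero`). So `Φφ` vanishes at `w`
exactly when `φ = (A - w)ψ`. Then `(A - w̄)ψ` gives (A2), with the same norm by symmetry; (A3) is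
the action of `J`. If `Φφ = 0`, then `f(z) = (A - z)⁻¹φ` exists for every `z`, is entire, and
satisfies `|Im z| ‖f(z)‖ ≤ ‖φ‖`. By the Liouville-type `eq_zero_of_abs_im_mul_norm_le`, `f = 0`, so
`φ = 0`. The Hilbert structure is carried over from `H` along `Φ`. -/

theorem mem_ranSub {A : H →ₗ.[ℂ] H} {z : ℂ} {y : H} :
    y ∈ ranSub A z ↔ ∃ φ : A.domain, A φ - z • (φ : H) = y :=
  Iff.rfl

theorem inner_of_mem_kerAdjointSub {A : H →ₗ.[ℂ] H} {z : ℂ} {η : H}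
    (hη : η ∈ kerAdjointSub A z) (φ : A.domain) :
    inner ℂ η (A φ) = conj z * inner ℂ η (φ : H) := by
  have h : (η, z • η) ∈ A.graph.adjoint := hη
  rw [Submodule.mem_adjoint_iff] at h
  have h1 := sub_eq_zero.1 (h _ _ (A.mem_graph φ))
  simp only [inner_smul_right] at h1
  rw [← inner_conj_symm, h1, map_mul, inner_conj_symm]

theorem inner_sub_smul_of_mem_kerAdjointSub {A : H →ₗ.[ℂ] H} {z : ℂ} {η : H}
    (hη : η ∈ kerAdjointSub A (conj z)) (w : ℂ) (φ : A.domain) :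
    inner ℂ η (A φ - w • (φ : H)) = (z - w) * inner ℂ η (φ : H) := by
  rw [inner_sub_right, inner_of_mem_kerAdjointSub hη, inner_smul_right, Complex.conj_conj]
  ring

theorem mem_orthogonal_of_mem_kerAdjointSub {A : H →ₗ.[ℂ] H} {z : ℂ} {η : H}
    (hη : η ∈ kerAdjointSub A (conj z)) : η ∈ (ranSub A z)ᗮ := by
  rw [Submodule.mem_orthogonal']
  rintro _ ⟨φ, rfl⟩
  change inner ℂ η (A φ - z • (φ : H)) = 0
  rw [inner_sub_smul_of_mem_kerAdjointSub hη, sub_self, zero_mul]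

theorem IsSymmetricOp.inner_map_self {A : H →ₗ.[ℂ] H} (hA : IsSymmetricOp A) (φ : A.domain) :
    inner ℂ (A φ) (φ : H) = inner ℂ (φ : H) (A φ) := by
  have h := hA (A.mem_graph φ)
  rw [Submodule.mem_adjoint_iff] at h
  exact sub_eq_zero.1 (h _ _ (A.mem_graph φ))

theorem IsSymmetricOp.im_inner_map_self {A : H →ₗ.[ℂ] H} (hA : IsSymmetricOp A)
    (φ : A.domain) : (inner ℂ (φ : H) (A φ)).im = 0 := by
  rw [← Complex.conj_eq_iff_im, inner_conj_symm, hA.inner_map_self]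

/-- Since `⟨φ, Aφ⟩` is real, the cross term of the squared norm sees only `Re w`. -/
theorem IsSymmetricOp.norm_sub_conj_smul {A : H →ₗ.[ℂ] H} (hA : IsSymmetricOp A) (w : ℂ)
    (φ : A.domain) : ‖A φ - conj w • (φ : H)‖ = ‖A φ - w • (φ : H)‖ := by
  have him := hA.im_inner_map_self φ
  have hsymm := hA.inner_map_self φ
  refine (sq_eq_sq₀ (norm_nonneg _) (norm_nonneg _)).1 ?_
  rw [@norm_sub_sq ℂ, @norm_sub_sq ℂ, norm_smul, norm_smul, inner_smul_right, inner_smul_right,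
    hsymm, RCLike.norm_conj]
  simp [him]

theorem IsSymmetricOp.abs_im_mul_norm_le {A : H →ₗ.[ℂ] H} (hA : IsSymmetricOp A) (z : ℂ)
    (φ : A.domain) : |z.im| * ‖(φ : H)‖ ≤ ‖A φ - z • (φ : H)‖ := by
  have him := hA.im_inner_map_self φ
  have hz : (inner ℂ (φ : H) (A φ - z • (φ : H))).im = -(z.im * ‖(φ : H)‖ ^ 2) := by
    rw [inner_sub_right, inner_smul_right, inner_self_eq_norm_sq_to_K, Complex.sub_im, him,
      zero_sub, neg_inj]
    change (z * ((‖(φ : H)‖ : ℝ) : ℂ) ^ 2).im = _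
    rw [← Complex.ofReal_pow, Complex.im_mul_ofReal]
  have hle : |z.im| * ‖(φ : H)‖ ^ 2 ≤ ‖(φ : H)‖ * ‖A φ - z • (φ : H)‖ := by
    refine le_trans ?_ (norm_inner_le_norm (𝕜 := ℂ) _ _)
    refine le_trans (le_of_eq ?_) (Complex.abs_im_le_norm _)
    rw [hz, abs_neg, abs_mul, abs_of_nonneg (sq_nonneg ‖(φ : H)‖)]
  rcases (norm_nonneg (φ : H)).eq_or_lt with h0 | h0
  · rw [← h0, mul_zero]
    exact norm_nonneg _
  · refine le_of_mul_le_mul_left ?_ h0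
    linarith [hle]

theorem half_mul_norm_le_of_mem_ball {A : H →ₗ.[ℂ] H} {w : ℂ} {c : ℝ}
    (hc : ∀ φ : A.domain, c * ‖(φ : H)‖ ≤ ‖A φ - w • (φ : H)‖) {z : ℂ} (hz : ‖z - w‖ < c / 2)
    (φ : A.domain) : c / 2 * ‖(φ : H)‖ ≤ ‖A φ - z • (φ : H)‖ := by
  have h1 : A φ - w • (φ : H) = (A φ - z • (φ : H)) + (z - w) • (φ : H) := by
    rw [sub_smul]; abel
  have h2 := hc φ
  rw [h1] at h2
  have h3 := norm_add_le (A φ - z • (φ : H)) ((z - w) • (φ : H))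
  rw [norm_smul] at h3
  have h4 := mul_le_mul_of_nonneg_right hz.le (norm_nonneg (φ : H))
  linarith

theorem IsRegularOp.eq_of_sub_eq {A : H →ₗ.[ℂ] H} (hA : IsRegularOp A) {z : ℂ}
    {φ ψ : A.domain} (h : A φ - z • (φ : H) = A ψ - z • (ψ : H)) : φ = ψ := by
  obtain ⟨c, hc, hle⟩ := hA z
  have h1 := hle (φ - ψ)
  have h2 : A (φ - ψ) - z • ((φ - ψ : A.domain) : H) = 0 := by
    rw [LinearPMap.map_sub, Submodule.coe_sub, smul_sub, sub_sub_sub_comm, h, sub_self]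
  rw [h2, norm_zero] at h1
  have h3 : ‖((φ - ψ : A.domain) : H)‖ = 0 :=
    le_antisymm (nonpos_of_mul_nonpos_right h1 hc) (norm_nonneg _)
  exact sub_eq_zero.1 (Subtype.ext (norm_eq_zero.1 h3))

theorem sub_smul_sub_of_sub_eq {A : H →ₗ.[ℂ] H} {z w : ℂ} {φ ψ : A.domain}
    (h : A φ - z • (φ : H) = A ψ - w • (ψ : H)) :
    A (φ - ψ) - z • ((φ - ψ : A.domain) : H) = (z - w) • (ψ : H) := by
  rw [LinearPMap.map_sub, Submodule.coe_sub, smul_sub, sub_sub_sub_comm, h, sub_smul]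
  abel

theorem IsRegularOp.isClosed_ranSub [CompleteSpace H] {A : H →ₗ.[ℂ] H} (hA : IsRegularOp A)
    (hcl : A.IsClosed) (z : ℂ) : IsClosed (ranSub A z : Set H) := by
  obtain ⟨c, hc, hle⟩ := hA z
  have hcl' : IsClosed (A.graph : Set (H × H)) := hcl
  have : CompleteSpace A.graph := hcl'.completeSpace_coe
  let T : A.graph →L[ℂ] H :=
    (ContinuousLinearMap.snd ℂ H H - z • ContinuousLinearMap.fst ℂ H H).comp A.graph.subtypeL
  have hT : ∀ p : A.graph, T p = (p : H × H).2 - z • (p : H × H).1 := fun p => rfl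
  have hrange : (ranSub A z : Set H) = Set.range T := by
    ext y
    constructor
    · rintro ⟨φ, rfl⟩
      exact ⟨⟨_, A.mem_graph φ⟩, rfl⟩
    · rintro ⟨⟨p, hp⟩, rfl⟩
      obtain ⟨φ, rfl⟩ := (A.mem_graph_iff').1 hp
      exact ⟨φ, rfl⟩
  -- `c⁻¹` controls `‖φ‖` and `1 + ‖z‖ c⁻¹` controls `‖Aφ‖`; their sum dominates the max norm on the
  -- graph.
  have hK : 0 ≤ c⁻¹ + (1 + ‖z‖ * c⁻¹) := by positivity
  have hanti : AntilipschitzWith ⟨c⁻¹ + (1 + ‖z‖ * c⁻¹), hK⟩ T := by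
    refine ContinuousLinearMap.antilipschitz_of_bound T ?_
    rintro ⟨p, hp⟩
    obtain ⟨φ, rfl⟩ := (A.mem_graph_iff').1 hp
    rw [hT]
    change ‖((φ : H), A φ)‖ ≤ (c⁻¹ + (1 + ‖z‖ * c⁻¹)) * ‖A φ - z • (φ : H)‖
    have h1 : ‖(φ : H)‖ ≤ c⁻¹ * ‖A φ - z • (φ : H)‖ := by
      rw [inv_mul_eq_div, le_div_iff₀ hc, mul_comm]
      exact hle φ
    have h2 : ‖A φ‖ ≤ ‖A φ - z • (φ : H)‖ + ‖z‖ * ‖(φ : H)‖ := by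
      rw [← norm_smul]
      simpa using norm_add_le (A φ - z • (φ : H)) (z • (φ : H))
    have h3 := mul_le_mul_of_nonneg_left h1 (norm_nonneg z)
    have h4 := norm_nonneg (A φ - z • (φ : H))
    have h5 : 0 ≤ c⁻¹ := by positivity
    have h6 : 0 ≤ c⁻¹ * ‖A φ - z • (φ : H)‖ := by positivity
    have h7 : 0 ≤ ‖z‖ * (c⁻¹ * ‖A φ - z • (φ : H)‖) := by positivity
    rw [Prod.norm_mk]
    refine max_le ?_ ?_ <;> nlinarith
  rw [hrange]
  exact hanti.isClosed_range T.uniformContinuous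

/-- The range of `A - z` and the orthogonal complement of the range of `A - w` meet only in zero
when `w` is close to `z`. -/
theorem eq_zero_of_mem_ranSub_of_mem_orthogonal {A : H →ₗ.[ℂ] H} {z w : ℂ} {c : ℝ}
    (hle : ∀ φ : A.domain, c * ‖(φ : H)‖ ≤ ‖A φ - z • (φ : H)‖) (hzw : ‖z - w‖ < c)
    {η : H} (hη : η ∈ ranSub A z) (hη' : η ∈ (ranSub A w)ᗮ) : η = 0 := by
  obtain ⟨φ, rfl⟩ := mem_ranSub.1 hη
  set η := A φ - z • (φ : H) with hdef
  have h1 : A φ - w • (φ : H) = η + (z - w) • (φ : H) := by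
    rw [hdef, sub_smul]; abel
  have h2 : inner ℂ η (A φ - w • (φ : H)) = 0 :=
    (Submodule.mem_orthogonal' _ _).1 hη' _ ⟨φ, rfl⟩
  rw [h1, inner_add_right, inner_smul_right] at h2
  have h3 : ‖η‖ * ‖η‖ ≤ ‖z - w‖ * (‖η‖ * ‖(φ : H)‖) := by
    have h4 : inner ℂ η η = -((z - w) * inner ℂ η (φ : H)) := eq_neg_of_add_eq_zero_left h2
    have h5 : ‖inner ℂ η η‖ = ‖η‖ * ‖η‖ := by
      rw [inner_self_eq_norm_sq_to_K]; simp [sq]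
    rw [← h5, h4, norm_neg, norm_mul]
    gcongr
    exact norm_inner_le_norm _ _
  by_contra hne
  have hpos : 0 < ‖η‖ := norm_pos_iff.2 hne
  have h6 : ‖η‖ ≤ ‖z - w‖ * ‖(φ : H)‖ := by
    refine le_of_mul_le_mul_left ?_ hpos
    linarith
  have h7 := hle φ
  rw [← hdef] at h7
  have h8 : (φ : H) ≠ 0 := by
    intro h0
    rw [h0, norm_zero, mul_zero] at h6
    linarith
  have h9 := mul_lt_mul_of_pos_right hzw (norm_pos_iff.2 h8)
  linarith

theorem IsRegularOp.continuous_of_sub_eq {A : H →ₗ.[ℂ] H} (hA : IsRegularOp A)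
    {f : ℂ → A.domain} {φ : H} (hf : ∀ z, A (f z) - z • (f z : H) = φ) :
    Continuous (fun z => (f z : H)) := by
  refine continuous_iff_continuousAt.2 fun w => ?_
  obtain ⟨c, hc, hle⟩ := hA w
  refine tendsto_iff_norm_sub_tendsto_zero.2 ?_
  have hlim : Filter.Tendsto (fun z => (c / 2)⁻¹ * (‖z - w‖ * ‖(f w : H)‖)) (nhds w) (nhds 0) := by
    have : Continuous (fun z => (c / 2)⁻¹ * (‖z - w‖ * ‖(f w : H)‖)) := by fun_prop
    simpa using this.tendsto w
  refine squeeze_zero' (Filter.Eventually.of_forall fun _ => norm_nonneg _) ?_ hlim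
  filter_upwards [Metric.ball_mem_nhds w (half_pos hc)] with z hz
  rw [mem_ball_iff_norm] at hz
  have h1 := half_mul_norm_le_of_mem_ball hle hz (f z - f w)
  rw [sub_smul_sub_of_sub_eq ((hf z).trans (hf w).symm), norm_smul] at h1
  rw [inv_mul_eq_div, le_div_iff₀ (half_pos hc), mul_comm]
  exact h1

/-- By the resolvent identity the difference quotient at `w` is `g(z) = (A - z)⁻¹ f(w)`, which
exists by `hmem` and is continuous in `z`. -/
theorem IsRegularOp.differentiable_of_sub_eq {A : H →ₗ.[ℂ] H} (hA : IsRegularOp A)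
    {f : ℂ → A.domain} {φ : H} (hf : ∀ z, A (f z) - z • (f z : H) = φ)
    (hmem : ∀ z w, (f w : H) ∈ ranSub A z) : Differentiable ℂ (fun z => (f z : H)) := by
  intro w
  choose g hg using fun z => mem_ranSub.1 (hmem z w)
  have hderiv : HasDerivAt (fun z => (f z : H)) (g w : H) w := by
    rw [hasDerivAt_iff_tendsto_slope]
    refine (((hA.continuous_of_sub_eq hg).tendsto w).mono_left nhdsWithin_le_nhds).congr' ?_
    filter_upwards [self_mem_nhdsWithin] with z hz
    have hzw : z - w ≠ 0 := sub_ne_zero.2 hz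
    have h1 : (z - w) • g z = f z - f w := by
      refine hA.eq_of_sub_eq (z := z) ?_
      rw [sub_smul_sub_of_sub_eq ((hf z).trans (hf w).symm), LinearPMap.map_smul,
        Submodule.coe_smul, smul_comm z, ← smul_sub, hg]
    rw [slope_def_module, ← Submodule.coe_sub, ← h1, Submodule.coe_smul, inv_smul_smul₀ hzw]
  exact hderiv.differentiableAt

end Operators

/-- An entire function which is bounded by a multiple of `|Im z|⁻¹` vanishes. -/
theorem eq_zero_of_abs_im_mul_norm_le {E : Type*} [NormedAddCommGroup E] [NormedSpace ℂ E]
    {f : ℂ → E} (hf : Differentiable ℂ f) {C : ℝ} (hC : ∀ z, |z.im| * ‖f z‖ ≤ C) (w : ℂ) :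
    f w = 0 := by
  have hbound : ∀ R : ℝ, ‖w‖ + 1 < R → ‖f w‖ * (R - ‖w‖) ≤ 2 * C := by
    intro R hR
    have hw := norm_nonneg w
    have hR0 : 0 < R := by linarith
    -- On `|z| = R` the factor `z² - R²` equals `z(z - z̄)`, of modulus `2R |Im z|`, which absorbs
    -- the blow-up of the bound at the real axis.
    have hg : Differentiable ℂ (fun z : ℂ => (z ^ 2 - (R : ℂ) ^ 2) • f z) := by fun_prop
    have hmax : ‖(w ^ 2 - (R : ℂ) ^ 2) • f w‖ ≤ 2 * R * C := by
      refine Complex.norm_le_of_forall_mem_frontier_norm_le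
        (f := fun z : ℂ => (z ^ 2 - (R : ℂ) ^ 2) • f z)
        (Metric.isBounded_ball (x := (0 : ℂ)) (r := R)) hg.diffContOnCl ?_
        (subset_closure (by simpa using (by linarith : ‖w‖ < R)))
      intro z hz
      rw [frontier_ball _ hR0.ne', mem_sphere_zero_iff_norm] at hz
      have h1 : z ^ 2 - (R : ℂ) ^ 2 = z * (2 * z.im * Complex.I) := by
        have h := Complex.sub_conj z
        push_cast at h
        rw [← hz, ← Complex.mul_conj', ← h]
        ring
      rw [h1, norm_smul, norm_mul, hz]
      have h2 : ‖(2 * z.im * Complex.I : ℂ)‖ = 2 * |z.im| := by simp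
      rw [h2]
      have := mul_le_mul_of_nonneg_left (hC z) hR0.le
      linarith
    rw [norm_smul] at hmax
    have h3 : R * (R - ‖w‖) ≤ ‖w ^ 2 - (R : ℂ) ^ 2‖ := by
      have h4 := norm_sub_norm_le ((R : ℂ) ^ 2) (w ^ 2)
      rw [norm_sub_rev, norm_pow, norm_pow, Complex.norm_real, Real.norm_eq_abs,
        abs_of_pos hR0] at h4
      nlinarith
    have h5 := mul_le_mul_of_nonneg_right h3 (norm_nonneg (f w))
    refine le_of_mul_le_mul_left ?_ hR0
    linarith
  by_contra hne
  have hpos : 0 < ‖f w‖ := norm_pos_iff.2 hne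
  have hC0 : 0 ≤ C := le_trans (by positivity) (hC w)
  have h := hbound (‖w‖ + 2 + 2 * C / ‖f w‖)
    (by have : 0 ≤ 2 * C / ‖f w‖ := by positivity
        linarith)
  have h' : ‖f w‖ * (‖w‖ + 2 + 2 * C / ‖f w‖ - ‖w‖) = 2 * ‖f w‖ + 2 * C := by
    field_simp
    ring
  linarith

/-! ### The kernel of evaluation at `z`, and injectivity of `Φ` -/

section Model

variable {H : Type*} [NormedAddCommGroup H] [InnerProductSpace ℂ H]

theorem modelMap_apply (ξ : ℂ → H) (φ : H) (z : ℂ) :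
    modelMap ξ φ z = inner ℂ (ξ (conj z)) φ :=
  rfl

/-- If the functional `⟨ξ(z̄), ·⟩` has kernel `ran (A - z)`, then so it is near `z`. -/
theorem IsModelFunction.mem_ranSub_of_near [CompleteSpace H] {A : H →ₗ.[ℂ] H} {J : H → H}
    {ξ : ℂ → H} (hξ : IsModelFunction A J ξ) (hreg : IsRegularOp A) (hcl : A.IsClosed)
    {z w : ℂ} {c : ℝ} (hle : ∀ φ : A.domain, c * ‖(φ : H)‖ ≤ ‖A φ - z • (φ : H)‖)
    (hzw : ‖z - w‖ < c)
    (hz : ∀ φ, inner ℂ (ξ (conj z)) φ = 0 → φ ∈ ranSub A z) {φ : H}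
    (hφ : inner ℂ (ξ (conj w)) φ = 0) : φ ∈ ranSub A w := by
  have : CompleteSpace (ranSub A w) := (hreg.isClosed_ranSub hcl w).completeSpace_coe
  obtain ⟨ψ, hψ, η, hη, rfl⟩ := (ranSub A w).exists_add_mem_mem_orthogonal φ
  have hξw := mem_orthogonal_of_mem_kerAdjointSub (hξ.mem_ker (conj w))
  rw [inner_add_right, (Submodule.mem_orthogonal' _ _).1 hξw ψ hψ, zero_add] at hφ
  set a : ℂ := inner ℂ (ξ (conj z)) (ξ (conj w)) with ha
  have ha0 : a ≠ 0 := fun h0 => hξ.zero_free (conj w)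
    (eq_zero_of_mem_ranSub_of_mem_orthogonal hle hzw (hz _ h0) hξw)
  set b : ℂ := inner ℂ (ξ (conj z)) η with hb
  -- This combination is orthogonal to `ξ(z̄)`, so it lies in `ran (A - z)` as well as in `(ran (A -
  -- w))ᗮ`. Pairing it with `η ⊥ ξ(w̄)` leaves `a ‖η‖² = 0`.
  have h0 : a • η - b • ξ (conj w) = 0 := by
    refine eq_zero_of_mem_ranSub_of_mem_orthogonal hle hzw (hz _ ?_)
      (Submodule.sub_mem _ (Submodule.smul_mem _ _ hη) (Submodule.smul_mem _ _ hξw))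
    rw [inner_sub_right, inner_smul_right, inner_smul_right, ← ha, ← hb]
    ring
  have h1 : inner ℂ η (a • η - b • ξ (conj w)) = 0 := by rw [h0, inner_zero_right]
  rw [inner_sub_right, inner_smul_right, inner_smul_right, inner_eq_zero_symm.1 hφ, mul_zero,
    sub_zero, mul_eq_zero, inner_self_eq_zero] at h1
  rw [h1.resolve_left ha0, add_zero]
  exact hψ

theorem IsModelFunction.mem_ranSub_I [CompleteSpace H] {A : H →ₗ.[ℂ] H} {J : H → H}
    {ξ : ℂ → H} (hξ : IsModelFunction A J ξ) (hA : ClassS A) {φ : H}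
    (hφ : inner ℂ (ξ (conj Complex.I)) φ = 0) : φ ∈ ranSub A Complex.I := by
  have hcs : CompleteSpace (ranSub A Complex.I) :=
    (hA.regular.isClosed_ranSub hA.closed Complex.I).completeSpace_coe
  obtain ⟨v, hv, hv0, hspan⟩ := (rank_submodule_eq_one_iff _).1 hA.nPlus_eq_one
  obtain ⟨r, hr⟩ := Submodule.mem_span_singleton.1
    (hspan (mem_orthogonal_of_mem_kerAdjointSub (hξ.mem_ker (conj Complex.I))))
  have hr0 : r ≠ 0 := by
    rintro rfl
    exact hξ.zero_free _ (by rw [← hr, zero_smul])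
  rw [← hr, inner_smul_left, mul_eq_zero, map_eq_zero] at hφ
  rw [← (ranSub A Complex.I).orthogonal_orthogonal, Submodule.mem_orthogonal]
  intro u hu
  obtain ⟨s, rfl⟩ := Submodule.mem_span_singleton.1 (hspan hu)
  rw [inner_smul_left, hφ.resolve_left hr0, mul_zero]

/-- The defect of `A - z` is one at every point: `ran (A - z)` is the orthogonal complement of
`ξ(z̄)`. -/
theorem IsModelFunction.mem_ranSub_of_inner_eq_zero [CompleteSpace H] {A : H →ₗ.[ℂ] H}
    {J : H → H} {ξ : ℂ → H} (hξ : IsModelFunction A J ξ) (hA : ClassS A) (z : ℂ) :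
    ∀ φ : H, inner ℂ (ξ (conj z)) φ = 0 → φ ∈ ranSub A z := by
  set S : Set ℂ := {z | ∀ φ : H, inner ℂ (ξ (conj z)) φ = 0 → φ ∈ ranSub A z} with hS
  have hopen : IsOpen S := by
    refine Metric.isOpen_iff.2 fun z hz => ?_
    obtain ⟨c, hc, hle⟩ := hA.regular z
    refine ⟨c, hc, fun w hw φ hφ => ?_⟩
    rw [Metric.mem_ball, dist_comm, dist_eq_norm] at hw
    exact hξ.mem_ranSub_of_near hA.regular hA.closed hle hw hz hφ
  have hclosed : IsClosed S := by
    -- The regularity constant at `z` could shrink as `z → w`; half the constant at `w` serves for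
    -- all nearby `z`.
    refine isClosed_of_closure_subset fun w hw φ hφ => ?_
    obtain ⟨c, hc, hle⟩ := hA.regular w
    obtain ⟨z, hz, hzw⟩ := Metric.mem_closure_iff.1 hw (c / 2) (half_pos hc)
    rw [dist_comm, dist_eq_norm] at hzw
    exact hξ.mem_ranSub_of_near hA.regular hA.closed
      (half_mul_norm_le_of_mem_ball hle hzw) hzw hz hφ
  have huniv : S = Set.univ :=
    IsClopen.eq_univ ⟨hclosed, hopen⟩ ⟨Complex.I, fun φ hφ => hξ.mem_ranSub_I hA hφ⟩
  exact huniv.symm.subset (Set.mem_univ z)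

theorem IsModelFunction.injective_modelMap [CompleteSpace H] {A : H →ₗ.[ℂ] H} {J : H → H}
    {ξ : ℂ → H} (hξ : IsModelFunction A J ξ) (hA : ClassS A) :
    Function.Injective (modelMap ξ) := by
  rw [injective_iff_map_eq_zero]
  intro φ hφ
  have hran := hξ.mem_ranSub_of_inner_eq_zero hA
  choose f hf using fun z => mem_ranSub.1 (hran z φ (congrFun hφ z))
  have hne : ∀ w z, z ≠ w → inner ℂ (ξ (conj z)) (f w : H) = 0 := by
    intro w z hzw
    have h1 := inner_sub_smul_of_mem_kerAdjointSub (hξ.mem_ker (conj z)) w (f w)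
    rw [hf, ← modelMap_apply, hφ, Pi.zero_apply] at h1
    exact (mul_eq_zero.1 h1.symm).resolve_left (sub_ne_zero.2 hzw)
  -- `Φ(f w)` vanishes off `w`, hence also at `w` by continuity.
  have hmem : ∀ z w, (f w : H) ∈ ranSub A z := by
    intro z w
    refine hran z _ ?_
    have hcont : Continuous (fun z => inner ℂ (ξ (conj z)) (f w : H)) :=
      (hξ.entire.continuous.comp Complex.continuous_conj).inner continuous_const
    have hzero : (fun z => inner ℂ (ξ (conj z)) (f w : H)) = fun _ => 0 :=
      hcont.ext_on (dense_compl_singleton w) continuous_const fun z hz => hne w z hz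
    exact congrFun hzero z
  have hf0 : (f 0 : H) = 0 :=
    eq_zero_of_abs_im_mul_norm_le (hA.regular.differentiable_of_sub_eq hf hmem) (C := ‖φ‖)
      (fun z => (hA.symmetric.abs_im_mul_norm_le z (f z)).trans_eq (by rw [hf])) 0
  have hf0' : f 0 = 0 := Subtype.ext hf0
  rw [← hf 0, hf0', LinearPMap.map_zero, Submodule.coe_zero, smul_zero, sub_zero]

theorem IsInvolution.norm_map {J : H → H} (hJ : IsInvolution J) (φ : H) : ‖J φ‖ = ‖φ‖ := by
  rw [@norm_eq_sqrt_re_inner ℂ, hJ.inner_map, ← @norm_eq_sqrt_re_inner ℂ]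

/-- Moving `J` across removes the conjugation of `z`: this yields both entireness of `Φφ` and (A3).
-/
theorem IsModelFunction.modelMap_involution {A : H →ₗ.[ℂ] H} {J : H → H} {ξ : ℂ → H}
    (hξ : IsModelFunction A J ξ) (hJ : IsInvolution J) (φ : H) (z : ℂ) :
    modelMap ξ (J φ) z = inner ℂ φ (ξ z) := by
  rw [modelMap_apply, ← hξ.real, hJ.inner_map]

theorem IsModelFunction.differentiable_modelMap {A : H →ₗ.[ℂ] H} {J : H → H} {ξ : ℂ → H}
    (hξ : IsModelFunction A J ξ) (hJ : IsInvolution J) (φ : H) :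
    Differentiable ℂ (modelMap ξ φ) := by
  have h : modelMap ξ φ = fun z => innerSL ℂ (J φ) (ξ z) := by
    funext z
    rw [innerSL_apply_apply, ← hξ.modelMap_involution hJ, hJ.involutive]
  rw [h]
  exact (innerSL ℂ (J φ)).differentiable.comp hξ.entire

end Model

/-! ### Transport of the Hilbert space structure -/

section Transport

variable {V H : Type*} [AddCommGroup V] [Module ℂ V] [NormedAddCommGroup H]
  [InnerProductSpace ℂ H]

/-- The inner product on `V` which a linear equivalence with `H` induces. -/
@[reducible]
noncomputable def coreOfLinearEquiv (e : H ≃ₗ[ℂ] V) : InnerProductSpace.Core ℂ V where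
  inner x y := inner ℂ (e.symm x) (e.symm y)
  conj_inner_symm x y := inner_conj_symm _ _
  re_inner_nonneg x := inner_self_nonneg
  add_left x y z := by rw [map_add, inner_add_left]
  smul_left x y r := by rw [map_smul, inner_smul_left]
  definite x hx := by
    rw [inner_self_eq_zero] at hx
    exact e.symm.map_eq_zero_iff.1 hx

theorem norm_coreOfLinearEquiv (e : H ≃ₗ[ℂ] V) (x : V) :
    (coreOfLinearEquiv e).toNormedAddCommGroup.norm x = ‖e.symm x‖ :=
  (@norm_eq_sqrt_re_inner ℂ H _ _ _ (e.symm x)).symm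

theorem isometry_symm_coreOfLinearEquiv (e : H ≃ₗ[ℂ] V) :
    letI := (coreOfLinearEquiv e).toNormedAddCommGroup
    Isometry e.symm := by
  let := (coreOfLinearEquiv e).toNormedAddCommGroup
  exact AddMonoidHomClass.isometry_of_norm e.symm fun x => (norm_coreOfLinearEquiv e x).symm

theorem continuous_symm_coreOfLinearEquiv (e : H ≃ₗ[ℂ] V) :
    letI := (coreOfLinearEquiv e).toNormedAddCommGroup
    Continuous e.symm := by
  let := (coreOfLinearEquiv e).toNormedAddCommGroup
  have hiso : Isometry e.symm := isometry_symm_coreOfLinearEquiv e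
  exact hiso.continuous

theorem completeSpace_coreOfLinearEquiv [CompleteSpace H] (e : H ≃ₗ[ℂ] V) :
    letI := (coreOfLinearEquiv e).toNormedAddCommGroup
    CompleteSpace V := by
  let := (coreOfLinearEquiv e).toNormedAddCommGroup
  have hiso : Isometry e.symm := isometry_symm_coreOfLinearEquiv e
  refine (completeSpace_iff_isComplete_range hiso.isUniformInducing).2 ?_
  rw [e.symm.surjective.range_eq]
  exact isComplete_univ

end Transport

end DeBrangesModel

theorem mainTheorem1 {H : Type*} [NormedAddCommGroup H] [InnerProductSpace ℂ H] [CompleteSpace H]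
    (A : H →ₗ.[ℂ] H) (hA : DeBrangesModel.ClassS A)
    (J : H → H) (hJ : DeBrangesModel.IsInvolution J)
    (ξ : ℂ → H) (hξ : DeBrangesModel.IsModelFunction A J ξ) :
    Function.Injective (DeBrangesModel.modelMap ξ) ∧
    ∃ ip : InnerProductSpace.Core ℂ (LinearMap.range (DeBrangesModel.modelMap ξ)),
      (∀ η φ : H,
        ip.inner ((DeBrangesModel.modelMap ξ).rangeRestrict η)
          ((DeBrangesModel.modelMap ξ).rangeRestrict φ) = inner ℂ η φ) ∧
      DeBrangesModel.IsDeBrangesSpace (LinearMap.range (DeBrangesModel.modelMap ξ)) ip := by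
  have hinj : Function.Injective (DeBrangesModel.modelMap ξ) := hξ.injective_modelMap hA
  let e := LinearEquiv.ofInjective (DeBrangesModel.modelMap ξ) hinj
  have he : ∀ φ, (DeBrangesModel.modelMap ξ).rangeRestrict φ = e φ := fun φ => rfl
  have hcoe : ∀ φ, (e φ : ℂ → ℂ) = DeBrangesModel.modelMap ξ φ := fun φ => rfl
  have hnorm : ∀ φ, DeBrangesModel.ipNorm _ (DeBrangesModel.coreOfLinearEquiv e) (e φ) = ‖φ‖ :=
    fun φ => (DeBrangesModel.norm_coreOfLinearEquiv e (e φ)).trans (by rw [e.symm_apply_apply])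
  refine ⟨hinj, DeBrangesModel.coreOfLinearEquiv e, fun η φ => ?_, ?_, ?_, ?_, ?_, ?_⟩
  · change inner ℂ (e.symm (e η)) (e.symm (e φ)) = _
    rw [e.symm_apply_apply, e.symm_apply_apply]
  · rintro ⟨_, φ, rfl⟩
    exact hξ.differentiable_modelMap hJ φ
  · exact DeBrangesModel.completeSpace_coreOfLinearEquiv e
  · intro w
    have hfun : (fun f : LinearMap.range (DeBrangesModel.modelMap ξ) => (f : ℂ → ℂ) w) =
        (fun φ : H => inner ℂ (ξ (conj w)) φ) ∘ e.symm := by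
      funext f
      obtain ⟨φ, rfl⟩ := e.surjective f
      rw [Function.comp_apply, e.symm_apply_apply, hcoe, DeBrangesModel.modelMap_apply]
    rw [hfun]
    have hcont : Continuous (fun φ : H => inner ℂ (ξ (conj w)) φ) :=
      continuous_const.inner continuous_id
    exact @Continuous.comp _ _ _ (DeBrangesModel.ipUniformSpace _ _).toTopologicalSpace _ _ _ _
      hcont (DeBrangesModel.continuous_symm_coreOfLinearEquiv e)
  · intro f w _ hfw
    obtain ⟨φ, rfl⟩ := e.surjective f
    -- The zero at `w` is the factor `z - w` of `Φ((A - w)ψ)`; replacing `w` by `w̄` in the operator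
    -- reflects it.
    obtain ⟨ψ, rfl⟩ := DeBrangesModel.mem_ranSub.1 (hξ.mem_ranSub_of_inner_eq_zero hA w φ hfw)
    refine ⟨e (A ψ - conj w • (ψ : H)), fun z hz => ?_, ?_⟩
    · have hzw : z - w ≠ 0 := sub_ne_zero.2 hz
      have hker := hξ.mem_ker (conj z)
      rw [hcoe, hcoe, DeBrangesModel.modelMap_apply, DeBrangesModel.modelMap_apply,
        DeBrangesModel.inner_sub_smul_of_mem_kerAdjointSub hker,
        DeBrangesModel.inner_sub_smul_of_mem_kerAdjointSub hker]
      field_simp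
    · rw [hnorm, hnorm, hA.symmetric.norm_sub_conj_smul]
  · intro f
    obtain ⟨φ, rfl⟩ := e.surjective f
    refine ⟨e (J φ), fun z => ?_, by rw [hnorm, hnorm, hJ.norm_map]⟩
    rw [hcoe, hcoe, hξ.modelMap_involution hJ, DeBrangesModel.modelMap_apply, Complex.conj_conj,
      inner_conj_symm]
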